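/- Let $\kappa$ be an uncountable regular cardinal (no assumption $\kappa^{<\kappa}=\kappa$ is made). A *tree* $T\subseteq\kappa^{<\kappa}$ is a set of sequences closed under initial segments; it is *limit-closed* if for every limit ordinal $\lambda<\kappa$ the union of every $\subseteq$-increasing sequence $\langle\sigma_\alpha:\alpha<\lambda\rangle$ of elements of $T$ is in $T$. The *stem* of $T$ is the longest node of $T$ that is comparable with every node of $T$. A *$\kappa$-Laver tree* is a limit-closed tree $T\subseteq\kappa^{<\kappa}$ that has a stem and is such that $|\{\beta<\kappa:\sigma^\frown\langle\beta\rangle\in T\}|=\kappa$ for every $\sigma\in T$ extending (or equal to) the stem. For $\sigma\in T$ put $T\uparrow\sigma:=\{\tau\in T:\sigma\subseteq\tau\text{ or }\tau\subseteq\sigma\}$. **Theorem.** Let $\mathbb P$ be any set of $\kappa$-Laver trees, ordered by inclusion (smaller trees are stronger conditions), such that $T\uparrow\sigma\in\mathbb P$ whenever $T\in\mathbb P$ and $\sigma\in T$. Then $\mathbb P$ adds a Cohen $\kappa$-real; that is, there is a $\mathbb P$-name $\dot c$ such that it is forced by every condition that $\dot c\in 2^\kappa$ and that every dense subset $D$ of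 the $\kappa$-Cohen forcing $2^{<\kappa}$ (ordered by end-extension) lying in the ground model contains an initial segment of $\dot c$. Specifically, let $x_{gen}$ be the $\mathbb P$-generic $\kappa$-real, i.e. $x_{gen}=\bigcup\{\mathrm{stem}(T):T\in G\}$ for the generic filter $G$. Then it is forced that $x_{gen}\in\kappa^\kappa$, and each $T\in\mathbb P$ forces that $x_{gen}$ is a branch of length $\kappa$ through $T$. Moreover, let $S_0\cup S_1=\{\alpha<\kappa:\mathrm{cf}(\alpha)=\omega\}$ be any partition into two disjoint stationary subsets of $\kappa$, and let $\varphi:\kappa^\kappa\to2^\kappa$ be defined by $$\varphi(x)(\alpha)=1\iff\sup\{x(\omega\cdot\alpha+n):n<\omega\}\in S_1 .$$ Then it is forced that $\varphi(x_{gen})$ is a Cohen $\kappa$-real over the ground model. -/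

import Mathlib

universe u v w

namespace LaverForcing

/-! ## Sequences and trees -/

/-- `BSeq κ A` is the set `A^{<κ}` of sequences of elements of `A` whose length is an ordinal
below `κ`. -/
structure BSeq (κ : Cardinal.{u}) (A : Type v) where
  /-- the length of the sequence -/
  len : Ordinal.{u}
  len_lt : len < κ.ord
  /-- the entries of the sequence -/
  val : Set.Iio len → A

/-- The set of ordinals below `κ`, i.e. `κ` itself as a von Neumann ordinal. -/
abbrev Below (κ : Cardinal.{u}) : Type (u + 1) := Set.Iio κ.ord

/-- The nodes of the tree `κ^{<κ}`. -/
abbrev Node (κ : Cardinal.{u}) : Type (u + 1) := BSeq κ (Below κ)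

/-- `σ ⊆ τ`: the sequence `σ` is an initial segment of `τ`. -/
def IsInit {κ : Cardinal.{u}} {A : Type v} (σ τ : BSeq κ A) : Prop :=
  ∃ h : σ.len ≤ τ.len, ∀ α : Set.Iio σ.len, σ.val α = τ.val ⟨α.1, lt_of_lt_of_le α.2 h⟩

/-- `τ` is the union (limit) of the family of sequences `s`. -/
def IsUnionOf {κ : Cardinal.{u}} {A : Type v} {ι : Type w} (τ : BSeq κ A) (s : ι → BSeq κ A) :
    Prop :=
  (∀ i, IsInit (s i) τ) ∧ ∀ ξ < τ.len, ∃ i, ξ < (s i).len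

/-- A tree in `κ^{<κ}`: a set of nodes closed under initial segments. -/
def IsTree {κ : Cardinal.{u}} (T : Set (Node κ)) : Prop :=
  ∀ τ ∈ T, ∀ σ, IsInit σ τ → σ ∈ T

/-- `T` contains the union of every increasing sequence of its nodes indexed by a limit ordinal
`lam < κ`. -/
def IsLimitClosed {κ : Cardinal.{u}} (T : Set (Node κ)) : Prop :=
  ∀ lam : Ordinal.{u}, Order.IsSuccLimit lam → lam < κ.ord →
    ∀ s : Set.Iio lam → Node κ, (∀ α, s α ∈ T) → (∀ α β, α ≤ β → IsInit (s α) (s β)) →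
      ∀ τ, IsUnionOf τ s → τ ∈ T

/-- `σ` is the stem of `T`: the longest node of `T` that is comparable with every node of `T`. -/
def IsStem {κ : Cardinal.{u}} (T : Set (Node κ)) (σ : Node κ) : Prop :=
  σ ∈ T ∧ (∀ τ ∈ T, IsInit σ τ ∨ IsInit τ σ) ∧
    ∀ ρ ∈ T, (∀ τ ∈ T, IsInit ρ τ ∨ IsInit τ ρ) → IsInit ρ σ

/-- `Succ_T(σ)`: the set of `β < κ` such that `σ⌢⟨β⟩ ∈ T`. -/
def succSet {κ : Cardinal.{u}} (T : Set (Node κ)) (σ : Node κ) : Set (Below κ) :=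
  {β | ∃ τ ∈ T, IsInit σ τ ∧ τ.len = Order.succ σ.len ∧
    ∃ h : σ.len < τ.len, τ.val ⟨σ.len, h⟩ = β}

/-- `κ`-Laver trees: limit-closed trees that have a stem, all of whose nodes extending the stem
have `κ` many immediate successors. -/
def IsLaverTree {κ : Cardinal.{u}} (T : Set (Node κ)) : Prop :=
  IsTree T ∧ IsLimitClosed T ∧
    ∃ ρ, IsStem T ρ ∧
      ∀ σ ∈ T, IsInit ρ σ → Cardinal.mk (succSet T σ) = Cardinal.lift.{u + 1} κ

/-- `T ↑ σ`: the nodes of `T` comparable with `σ`. -/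
def restrict {κ : Cardinal.{u}} (T : Set (Node κ)) (σ : Node κ) : Set (Node κ) :=
  {τ ∈ T | IsInit σ τ ∨ IsInit τ σ}

/-! ## Forcing

For a preorder `P` (smaller conditions are stronger) we take the usual `P`-names and the usual
definition of the forcing relation by recursion. A sentence of the forcing language is identified
with the set of conditions that force it. -/

/-- `P`-names: a name is a set of pairs (name, condition), given here as an indexed family. -/
inductive PName (P : Type w) : Type (w + 1)
  | mk (ι : Type w) (nm : ι → PName P) (cond : ι → P) : PName P

section Language

variable {P : Type w} [Preorder P]

/-- The set of conditions `D` is dense below `p`. -/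
def DenseBelow (p : P) (D : P → Prop) : Prop := ∀ q ≤ p, ∃ r ≤ q, D r

/-- `fEq x y p` means `p ⊩ x = y`. -/
def fEq : PName P → PName P → P → Prop
  | .mk ι A a, .mk ι' B b => fun p =>
    (∀ i : ι, ∀ q ≤ p, q ≤ a i → DenseBelow q fun r => ∃ j : ι', r ≤ b j ∧ fEq (A i) (B j) r) ∧
    (∀ j : ι', ∀ q ≤ p, q ≤ b j → DenseBelow q fun r => ∃ i : ι, r ≤ a i ∧ fEq (A i) (B j) r)

/-- `fMem x y p` means `p ⊩ x ∈ y`. -/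
def fMem (x : PName P) : PName P → P → Prop
  | .mk ι B b => fun p => DenseBelow p fun q => ∃ j : ι, q ≤ b j ∧ fEq x (B j) q

/-- The sentence asserting a fact `φ` about objects of the ground model. -/
def fPure (φ : Prop) : P → Prop := fun _ => φ

/-- Conjunction. -/
def fAnd (φ ψ : P → Prop) : P → Prop := fun p => φ p ∧ ψ p

/-- Implication. -/
def fImp (φ ψ : P → Prop) : P → Prop := fun p => ∀ q ≤ p, φ q → ψ q

/-- Equivalence. -/
def fIff (φ ψ : P → Prop) : P → Prop := fAnd (fImp φ ψ) (fImp ψ φ)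

/-- Universal quantification: over all names when `ι` is `PName P`, and over the elements of a
ground model set when `ι` is the type of its elements. -/
def fAll {ι : Type v} (φ : ι → P → Prop) : P → Prop := fun p => ∀ i, φ i p

/-- Existential quantification, over the same ranges. -/
def fEx {ι : Type v} (φ : ι → P → Prop) : P → Prop := fun p => DenseBelow p fun q => ∃ i, φ i q

/-- The sentence `φ` is forced by every condition, i.e. `P ⊩ φ`. -/
def Forced (φ : P → Prop) : Prop := ∀ p, φ p

end Language

/-- The name of the unordered pair `{x, y}`. -/
def upairName {P : Type w} (x y : PName P) : PName P :=
  .mk (Bool × P) (fun i => if i.1 then x else y) (fun i => i.2)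

/-- The name of the Kuratowski ordered pair `⟨x, y⟩ = {{x}, {x, y}}`. -/
def pairName {P : Type w} (x y : PName P) : PName P :=
  upairName (upairName x x) (upairName x y)

/-- The check name of the von Neumann ordinal `α`, that is
`{⟨β̌, p⟩ : β < α, p ∈ P}`. -/
def ordName {P : Type (u + 1)} (α : Ordinal.{u}) : PName P :=
  .mk (Set.Iio α × P) (fun i => ordName i.1.1) (fun i => i.2)
termination_by α
decreasing_by exact i.1.2

section Reals

variable {P : Type (u + 1)} [Preorder P]

/-- The sentence `f(α) = β`, i.e. `⟨α, β⟩ ∈ f`. -/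
def fApp (f : PName P) (α β : Ordinal.{u}) : P → Prop :=
  fMem (pairName (ordName α) (ordName β)) f

/-- The sentence "`f` is a function from `δ` to `ε`", for ordinals `δ` and `ε`. -/
def fFun (f : PName P) (δ ε : Ordinal.{u}) : P → Prop :=
  fAnd
    (fAll fun z : PName P => fImp (fMem z f)
      (fEx fun α : Set.Iio δ => fEx fun β : Set.Iio ε =>
        fEq z (pairName (ordName α.1) (ordName β.1))))
    (fAnd
      (fAll fun α : Set.Iio δ => fEx fun β : Set.Iio ε => fApp f α.1 β.1)
      (fAll fun α : Set.Iio δ => fAll fun β : Set.Iio ε => fAll fun γ : Set.Iio ε =>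
        fImp (fAnd (fApp f α.1 β.1) (fApp f α.1 γ.1)) (fEq (ordName β.1) (ordName γ.1))))

/-- A bit as an ordinal. -/
def bit (b : Bool) : Ordinal.{u} := if b then 1 else 0

/-- The sentence `t ⊆ c`, for `t ∈ 2^{<κ}` in the ground model and `c ∈ 2^κ`. -/
def fExtendsBits {κ : Cardinal.{u}} (c : PName P) (t : BSeq κ Bool) : P → Prop :=
  fAll fun α : Set.Iio t.len => fApp c α.1 (bit (t.val α))

/-- The sentence `σ ⊆ x`, for `σ ∈ κ^{<κ}` in the ground model and `x ∈ κ^κ`. -/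
def fExtends {κ : Cardinal.{u}} (x : PName P) (σ : Node κ) : P → Prop :=
  fAll fun α : Set.Iio σ.len => fApp x α.1 (σ.val α).1

/-- The sentence `x ∈ [T]` for a tree `T` of the ground model: `x ∈ κ^κ` and all proper initial
segments of `x` belong to `T`. -/
def fBranch {κ : Cardinal.{u}} (x : PName P) (T : Set (Node κ)) : P → Prop :=
  fAnd (fFun x κ.ord κ.ord)
    (fAll fun α : Below κ => fEx fun σ : {σ : Node κ // σ ∈ T ∧ σ.len = α.1} => fExtends x σ.1)

/-- A set of conditions of `κ`-Cohen forcing `2^{<κ}` (ordered by end-extension) is dense. -/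
def IsCohenDense {κ : Cardinal.{u}} (D : Set (BSeq κ Bool)) : Prop :=
  ∀ s, ∃ t ∈ D, IsInit s t

/-- The sentence "`c` is a Cohen `κ`-real over the ground model": `c ∈ 2^κ` and every dense subset
`D` of `κ`-Cohen forcing that lies in the ground model contains an initial segment of `c`. -/
def fCohen (κ : Cardinal.{u}) (c : PName P) : P → Prop :=
  fAnd (fFun c κ.ord 2)
    (fAll fun D : {D : Set (BSeq κ Bool) // IsCohenDense D} =>
      fEx fun t : D.1 => fExtendsBits c t.1)

/-- The sentence `β = sup {x(ω·α + n) : n < ω}`: `β` is an upper bound of this set, and it is below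
every upper bound. -/
def fBlockSup (x : PName P) (α β : Ordinal.{u}) : P → Prop :=
  let bound : Ordinal.{u} → P → Prop := fun δ =>
    fAll fun n : ℕ => fAll fun γ : Ordinal.{u} =>
      fImp (fApp x (Ordinal.omega0 * α + n) γ) (fPure (γ ≤ δ))
  fAnd (bound β) (fAll fun δ : Ordinal.{u} => fImp (bound δ) (fPure (β ≤ δ)))

/-- The sentence `c = φ(x)`, where `φ : κ^κ → 2^κ` is the map with
`φ(x)(α) = 1 ↔ sup {x(ω·α + n) : n < ω} ∈ S`. -/
def fPhi {κ : Cardinal.{u}} (S : Set (Below κ)) (x c : PName P) : P → Prop :=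
  fAnd (fFun c κ.ord 2)
    (fAll fun α : Below κ =>
      fIff (fApp c α.1 1) (fEx fun β : S => fBlockSup x α.1 β.1.1))

end Reals

/-- The forcing `P` adds a Cohen `κ`-real: some `P`-name is forced to be one. -/
def AddsCohenReal (κ : Cardinal.{u}) (P : Type (u + 1)) [Preorder P] : Prop :=
  ∃ c : PName P, Forced (fCohen κ c)

/-- The canonical name of the generic `κ`-real `x_gen = ⋃ {stem(T) : T ∈ G}` of a forcing `P` whose
conditions are trees (ordered by inclusion):
`{⟨⟨α, σ(α)⟩ˇ, T⟩ : T ∈ P, σ = stem(T), α < len(σ)}`. -/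
def genericReal {κ : Cardinal.{u}} (P : Set (Set (Node κ))) : PName P :=
  .mk (Σ i : {i : P × Node κ // IsStem i.1.1 i.2}, Set.Iio i.1.2.len)
    (fun i => pairName (ordName i.2.1) (ordName (i.1.1.2.val i.2).1))
    (fun i => i.1.1.1)

/-- `Cof_ω(κ)`: the ordinals below `κ` of cofinality `ω`. -/
def cofOmega (κ : Cardinal.{u}) : Set (Below κ) := {α | α.1.cof = Cardinal.aleph0}

end LaverForcing

namespace LaverForcing

/-! ### Clubs and stationary sets below a regular uncountable cardinal. -/

section Club

variable {κ : Cardinal.{u}}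

/-! Stems carry all the information about the generic real. A Laver tree has nodes above its stem of
every larger length below κ, restricting it to such a node makes that node the stem, and stems
lengthen as conditions shrink. So a condition decides x_gen(α) exactly when α is below the length of
its stem (`fApp_genericReal`), and it decides a bit of φ(x_gen) once its stem covers the
corresponding block of length ω.

The heart is `exists_block`: above the stem, ω further entries can be chosen with supremum in any
prescribed stationary set S of ordinals of cofinality ω. Fix a strategy that answers each of a
finite list of lower bounds by a successor with a larger entry. Its closure points form a club, so
some δ in S is one of them. Against a ladder cofinal in δ, the entries stay below δ and exceed the
ladder, so their supremum is δ. Only finite lists occur, and fewer than κ of them below a given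
ordinal; this is why κ^{<κ} = κ is not needed.

Using S₀ and S₁, arbitrary bits can be written block by block, with limit closure handling limit
stages (`exists_coding`). Given a condition and a Cohen-dense D, extend the stem to a node of length
ω·α, read off the α bits it already codes, extend them to some t in D and code the rest of t.
Restricting to the resulting node forces t ⊆ φ(x_gen) (`fCohen_codeName`). That some Cohen real is
added also needs one suitable partition, obtained from Fodor's lemma
(`exists_stationary_partition`). -/

theorem cof_below (hκ : κ.IsRegular) : Order.cof (Below κ) = Cardinal.lift.{u + 1} κ := by
  rw [Ordinal.cof_Iio, ← Ordinal.lift_cof, hκ.cof_ord]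

theorem cof_below_ne_aleph0 (hκ : κ.IsRegular) (hκ' : Cardinal.aleph0 < κ) :
    Order.cof (Below κ) ≠ Cardinal.aleph0 := by
  rw [cof_below hκ]
  exact (Cardinal.aleph0_lt_lift.2 hκ').ne'

theorem noMaxOrder_below (hκ : κ.IsRegular) : NoMaxOrder (Below κ) where
  exists_gt a := ⟨⟨Order.succ a.1, (Cardinal.isSuccLimit_ord hκ.aleph0_le).succ_lt a.2⟩,
    Order.lt_succ a.1⟩

theorem nonempty_below (hκ : κ.IsRegular) : Nonempty (Below κ) := ⟨⟨0, hκ.ord_pos⟩⟩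

theorem exists_forall_lt_of_mk_lt (hκ : κ.IsRegular) {s : Set (Below κ)}
    (hs : Cardinal.mk s < Cardinal.lift.{u + 1} κ) : ∃ b, ∀ a ∈ s, a < b := by
  have := noMaxOrder_below hκ
  obtain ⟨b, hb⟩ : BddAbove s := .of_not_isCofinal fun h => by
    have := Order.cof_le h
    rw [cof_below hκ] at this
    exact this.not_gt hs
  obtain ⟨c, hc⟩ := exists_gt b
  exact ⟨c, fun a ha => (hb ha).trans_lt hc⟩

theorem exists_forall_lt_nat (hκ : κ.IsRegular) (hκ' : Cardinal.aleph0 < κ) (f : ℕ → Below κ) :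
    ∃ b, ∀ n, f n < b := by
  obtain ⟨b, hb⟩ := exists_forall_lt_of_mk_lt hκ (s := Set.range f)
    (((Set.countable_range f).le_aleph0).trans_lt (Cardinal.aleph0_lt_lift.2 hκ'))
  exact ⟨b, fun n => hb _ ⟨n, rfl⟩⟩

theorem exists_isLUB_range (hκ : κ.IsRegular) (hκ' : Cardinal.aleph0 < κ) (f : ℕ → Below κ) :
    ∃ b, IsLUB (Set.range f) b := by
  obtain ⟨b, hb⟩ := exists_forall_lt_nat hκ hκ' f
  have hne : (upperBounds (Set.range f)).Nonempty := ⟨b, by rintro _ ⟨n, rfl⟩; exact (hb n).le⟩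
  exact ⟨wellFounded_lt.min _ hne, wellFounded_lt.min_mem _ hne,
    fun c hc => not_lt.1 (wellFounded_lt.not_lt_min _ hc)⟩

theorem mk_Iio_below_lt (a : Below κ) :
    Cardinal.mk (Set.Iio a) < Cardinal.lift.{u + 1} κ := by
  have h : Cardinal.mk (Set.Iio a) ≤ Cardinal.mk (Set.Iio a.1) :=
    Cardinal.mk_le_of_injective (f := fun x : Set.Iio a => (⟨x.1.1, x.2⟩ : Set.Iio a.1))
      fun x y h => Subtype.ext (Subtype.ext (congrArg (fun z : Set.Iio a.1 => z.1) h))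
  refine h.trans_lt ?_
  rw [Cardinal.mk_Iio_ordinal, Cardinal.lift_lt]
  exact Cardinal.lt_ord.1 a.2

theorem exists_gt_of_mk_eq (hκ : κ.IsRegular) {s : Set (Below κ)}
    (hs : Cardinal.mk s = Cardinal.lift.{u + 1} κ) (a : Below κ) : ∃ b ∈ s, a < b := by
  have := noMaxOrder_below hκ
  obtain ⟨c, hc⟩ := exists_gt a
  by_contra! h
  have hsub : s ⊆ Set.Iio c := fun b hb => (h b hb).trans_lt hc
  exact ((Cardinal.mk_le_mk_of_subset hsub).trans_lt (mk_Iio_below_lt c)).ne hs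

/-- The points closed under a finitary function `κ^{<ω} → κ` form a club. -/
theorem isClub_closedUnder (hκ : κ.IsRegular) (hκ' : Cardinal.aleph0 < κ)
    (F : List (Below κ) → Below κ) :
    IsClub {δ | ∀ l : List (Below κ), (∀ x ∈ l, x < δ) → F l < δ} := by
  constructor
  · intro d hd hd₀ _ a ha l hl
    have : ∃ y ∈ d, ∀ x ∈ l, x < y := by
      clear hd
      induction l with
      | nil => obtain ⟨y, hy⟩ := hd₀; exact ⟨y, hy, by simp⟩
      | cons x l ih =>
        obtain ⟨y, hy, hyl⟩ := ih fun z hz => hl z (List.mem_cons_of_mem _ hz)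
        obtain ⟨z, hz, hxz⟩ := (lt_isLUB_iff ha).1 (hl x List.mem_cons_self)
        rcases le_total y z with h | h
        · exact ⟨z, hz, by simpa using ⟨hxz, fun w h1 h2 => (hyl _ h2).trans_le h⟩⟩
        · exact ⟨y, hy, by simpa using ⟨hxz.trans_le h, fun w h1 h2 => hyl _ h2⟩⟩
    obtain ⟨y, hy, hyl⟩ := this
    exact (hd hy l hyl).trans_le (ha.1 hy)
  · intro a
    have step : ∀ δ : Below κ, ∃ ε, δ < ε ∧
        ∀ l : List (Below κ), (∀ x ∈ l, x < δ) → F l < ε := by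
      intro δ
      let g : List (Set.Iio δ) → Below κ := fun l => F (l.map Subtype.val)
      -- Finite lists from a set of size below κ number at most max(ℵ₀, size), hence fewer than κ.
      have hg : Cardinal.mk (Set.range g) < Cardinal.lift.{u + 1} κ := by
        refine Cardinal.mk_range_le.trans_lt ((Cardinal.mk_list_le_max _).trans_lt ?_)
        exact max_lt (Cardinal.aleph0_lt_lift.2 hκ') (mk_Iio_below_lt δ)
      obtain ⟨b, hb⟩ := exists_forall_lt_of_mk_lt hκ hg
      have := noMaxOrder_below hκ
      obtain ⟨c, hc⟩ := exists_gt (max b δ)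
      refine ⟨c, (le_max_right _ _).trans_lt hc, fun l hl => ?_⟩
      refine (hb _ ⟨l.attach.map fun x => ⟨x.1, hl _ x.2⟩, ?_⟩).trans
        ((le_max_left _ _).trans_lt hc)
      simp only [g, List.map_map]
      exact congrArg F l.attach_map_subtype_val
    choose next hnext hF using step
    let g : ℕ → Below κ := fun n => next^[n] a
    have gsucc : ∀ n, g (n + 1) = next (g n) := fun n => Function.iterate_succ_apply' _ _ _
    obtain ⟨b, hb⟩ := exists_isLUB_range hκ hκ' g
    have gmono : StrictMono g := strictMono_nat_of_lt_succ fun n => by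
      rw [gsucc]; exact hnext _
    refine ⟨b, fun l hl => ?_, hb.1 ⟨0, rfl⟩⟩
    have : ∃ n, ∀ x ∈ l, x < g n := by
      induction l with
      | nil => exact ⟨0, by simp⟩
      | cons x l ih =>
        obtain ⟨n, hn⟩ := ih fun z hz => hl z (List.mem_cons_of_mem _ hz)
        obtain ⟨_, ⟨m, rfl⟩, hxz⟩ := (lt_isLUB_iff hb).1 (hl x List.mem_cons_self)
        refine ⟨max m n, ?_⟩
        simpa using ⟨hxz.trans_le (gmono.monotone (le_max_left _ _)),
          fun w h1 h2 => (hn _ h2).trans_le (gmono.monotone (le_max_right _ _))⟩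
    obtain ⟨n, hn⟩ := this
    refine (hF _ l hn).trans_le ?_
    rw [← gsucc]
    exact hb.1 ⟨_, rfl⟩

/-- Fodor's pressing-down lemma. -/
theorem exists_isStationary_fiber (hκ : κ.IsRegular) (hκ' : Cardinal.aleph0 < κ)
    {S : Set (Below κ)} (hS : IsStationary S) {f : Below κ → Below κ}
    (hf : ∀ δ ∈ S, f δ < δ) : ∃ γ, IsStationary {δ ∈ S | f δ = γ} := by
  by_contra! h
  simp_rw [not_isStationary_iff] at h
  choose C hC hdisj using h
  have := noMaxOrder_below hκ
  have hgt : ∀ γ ξ, ∃ ε ∈ C γ, ξ < ε := fun γ ξ => by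
    obtain ⟨η, hη⟩ := exists_gt ξ
    obtain ⟨ε, hε, h⟩ := (hC γ).isCofinal η
    exact ⟨ε, hε, hη.trans_le h⟩
  choose next hnext hlt using hgt
  obtain ⟨b⟩ := nonempty_below hκ
  -- Only pairs matter: closure gives `next γ ξ < δ` for γ, ξ < δ, so δ lies in the diagonal
  -- intersection of the `C γ`. The default `b` makes the empty list yield `b < δ`, so that δ has a
  -- point below it.
  let F : List (Below κ) → Below κ := fun l => match l with
    | [γ, ξ] => next γ ξ
    | _ => b
  obtain ⟨δ, hδS, hδ⟩ := hS (isClub_closedUnder hκ hκ' F)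
  have hmem : δ ∈ C (f δ) := by
    have hcl : ∀ ξ < δ, next (f δ) ξ < δ := fun ξ hξ =>
      hδ [f δ, ξ] (by simpa using ⟨hf δ hδS, hξ⟩)
    refine (hC (f δ)).isLUB_mem (t := {x ∈ C (f δ) | x < δ}) (fun x hx => hx.1)
      ⟨_, hnext _ b, hcl b (hδ [] (by simp))⟩ ⟨fun x hx => hx.2.le, fun x hx => ?_⟩
    by_contra! hxδ
    exact (hx ⟨hnext _ x, hcl x hxδ⟩).not_gt (hlt _ _)
  exact Set.disjoint_left.1 (hdisj (f δ)) ⟨hδS, rfl⟩ hmem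

/-- Any club contains a strictly increasing ω-sequence, and the supremum of that sequence is in the
club and has cofinality ω. -/
theorem isStationary_cofOmega (hκ : κ.IsRegular) (hκ' : Cardinal.aleph0 < κ) :
    IsStationary (cofOmega κ) := by
  intro C hC
  have := noMaxOrder_below hκ
  have hgt : ∀ ξ, ∃ ε ∈ C, ξ < ε := fun ξ => by
    obtain ⟨η, hη⟩ := exists_gt ξ
    obtain ⟨ε, hε, h⟩ := hC.isCofinal η
    exact ⟨ε, hε, hη.trans_le h⟩
  choose next hnext hlt using hgt
  obtain ⟨a⟩ := nonempty_below hκ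
  let g : ℕ → Below κ := fun n => next^[n] (next a)
  have gsucc : ∀ n, g (n + 1) = next (g n) := fun n => Function.iterate_succ_apply' _ _ _
  have gmem : ∀ n, g n ∈ C := fun n => by
    cases n with
    | zero => exact hnext a
    | succ n => rw [gsucc]; exact hnext _
  have gmono : StrictMono g := strictMono_nat_of_lt_succ fun n => by
    rw [gsucc]; exact hlt _
  obtain ⟨b, hb⟩ := exists_isLUB_range hκ hκ' g
  refine ⟨b, ?_, hC.isLUB_mem (by rintro _ ⟨n, rfl⟩; exact gmem n) (Set.range_nonempty g) hb⟩
  have hsup : ⨆ n, (g n).1 = b.1 := by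
    apply le_antisymm
    · exact ciSup_le' fun n => hb.1 ⟨n, rfl⟩
    · have hlt : ⨆ n, (g n).1 ≤ b.1 := ciSup_le' fun n => hb.1 ⟨n, rfl⟩
      have hub : (⟨⨆ n, (g n).1, hlt.trans_lt b.2⟩ : Below κ) ∈ upperBounds (Set.range g) := by
        rintro _ ⟨n, rfl⟩
        exact le_ciSup (f := fun n => (g n).1) Ordinal.bddAbove_of_small n
      exact hb.2 hub
  have hcof := Ordinal.lift_cof_iSup (f := fun n => (g n).1) fun m n h => gmono h
  rw [hsup] at hcof
  simpa [cofOmega] using hcof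

theorem exists_ladder {δ : Below κ} (hδ : δ ∈ cofOmega κ) :
    ∃ a : ℕ → Below κ, (∀ n, a n < δ) ∧ ∀ ξ < δ, ∃ n, ξ ≤ a n := by
  obtain ⟨f, hf⟩ := Ordinal.exists_isFundamentalSeq (o := δ.1) (a := Ordinal.omega0)
    (by rw [show δ.1.cof = _ from hδ, Cardinal.ord_aleph0])
  refine ⟨fun n => ⟨(f ⟨n, Ordinal.natCast_lt_omega0 n⟩).1,
      lt_trans (Set.mem_Iio.1 (f ⟨n, Ordinal.natCast_lt_omega0 n⟩).2) (Set.mem_Iio.1 δ.2)⟩,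
    fun n => (f ⟨n, _⟩).2, fun ξ hξ => ?_⟩
  obtain ⟨_, ⟨i, rfl⟩, hi⟩ := hf.isCofinal_range ⟨ξ.1, hξ⟩
  obtain ⟨n, hn⟩ := Ordinal.lt_omega0.1 i.2
  refine ⟨n, ?_⟩
  have : i = ⟨n, Ordinal.natCast_lt_omega0 n⟩ := Subtype.ext hn
  subst this
  exact hi

/-- The set of ordinals of cofinality `ω` splits into two stationary sets. -/
theorem exists_stationary_partition (hκ : κ.IsRegular) (hκ' : Cardinal.aleph0 < κ) :
    ∃ S₀ S₁ : Set (Below κ), S₀ ∪ S₁ = cofOmega κ ∧ Disjoint S₀ S₁ ∧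
      IsStationary S₀ ∧ IsStationary S₁ := by
  classical
  have hcof := cof_below_ne_aleph0 hκ hκ'
  have := noMaxOrder_below hκ
  have hlad : ∀ δ : Below κ, ∃ a : ℕ → Below κ, δ ∈ cofOmega κ →
      (∀ n, a n < δ) ∧ ∀ ξ < δ, ∃ n, ξ ≤ a n := fun δ => by
    by_cases h : δ ∈ cofOmega κ
    · obtain ⟨a, ha⟩ := exists_ladder h
      exact ⟨a, fun _ => ha⟩
    · exact ⟨fun _ => δ, fun h' => (h h').elim⟩
  choose a ha using hlad
  -- Some fixed rung of the ladders is stationarily often above any given bound. Otherwise each rung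
  -- n has a bad bound `η n`. Every δ of cofinality ω above all of these is in one of the bad sets,
  -- so countably many nonstationary sets would have a stationary union.
  obtain ⟨n, hn⟩ : ∃ n, ∀ η, IsStationary {δ ∈ cofOmega κ | η ≤ a δ n} := by
    by_contra! h
    choose η hη using h
    obtain ⟨b, hb⟩ := exists_forall_lt_nat hκ hκ' η
    have hst : IsStationary (⋃ n, {δ ∈ cofOmega κ | η n ≤ a δ n}) := by
      intro C hC
      have hclub : IsClub (Set.Ioi b) := by
        constructor
        · intro d hd ⟨x, hx⟩ _ y hy
          exact (hd hx).trans_le (hy.1 hx)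
        · intro x
          obtain ⟨c, hc⟩ := exists_gt (max b x)
          exact ⟨c, (le_max_left _ _).trans_lt hc, ((le_max_right _ _).trans_lt hc).le⟩
      obtain ⟨δ, hδ, hbδ, hδC⟩ := isStationary_cofOmega hκ hκ' (hclub.inter hcof hC)
      obtain ⟨n, hn⟩ := (ha δ hδ).2 b hbδ
      exact ⟨δ, Set.mem_iUnion.2 ⟨n, hδ, (hb n).le.trans hn⟩, hδC⟩
    obtain ⟨n, hn⟩ := (isStationary_iUnion_iff_of_countable hcof).1 hst
    exact hη n hn
  obtain ⟨b⟩ := nonempty_below hκ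
  obtain ⟨γ, hγ⟩ := exists_isStationary_fiber hκ hκ' (hn b) (f := fun δ => a δ n)
    fun δ hδ => (ha δ hδ.1).1 n
  -- Pressing down again with rungs above γ yields a second constant value γ' > γ; the two fibers
  -- are disjoint.
  obtain ⟨c, hc⟩ := exists_gt γ
  obtain ⟨γ', hγ'⟩ := exists_isStationary_fiber hκ hκ' (hn c) (f := fun δ => a δ n)
    fun δ hδ => (ha δ hδ.1).1 n
  have hne : γ < γ' := by
    obtain ⟨δ, ⟨_, h⟩, h'⟩ := hγ'.nonempty
    rw [← h']
    exact hc.trans_le h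
  refine ⟨{δ ∈ cofOmega κ | a δ n ≠ γ'}, {δ ∈ cofOmega κ | a δ n = γ'}, ?_, ?_, ?_, ?_⟩
  · ext δ
    simp only [Set.mem_union, Set.mem_ofPred_eq]
    tauto
  · exact Set.disjoint_left.2 fun δ h h' => h.2 h'.2
  · exact hγ.mono fun δ h => ⟨h.1.1, fun h' => hne.ne (h.2.symm.trans h')⟩
  · exact hγ'.mono fun δ h => ⟨h.1.1, h.2⟩

end Club

/-! ### Sequences, initial segments and extension by Zorn's lemma. -/

section Sequences

variable {κ : Cardinal.{u}} {A : Type v}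

/-- The entry of `σ` at position `ξ` exists and equals `a`. -/
def HasVal (σ : BSeq κ A) (ξ : Ordinal.{u}) (a : A) : Prop :=
  ∃ h : ξ < σ.len, σ.val ⟨ξ, h⟩ = a

theorem exists_hasVal {σ : BSeq κ A} {ξ : Ordinal.{u}} (h : ξ < σ.len) : ∃ a, HasVal σ ξ a :=
  ⟨_, h, rfl⟩

theorem HasVal.unique {σ : BSeq κ A} {ξ : Ordinal.{u}} {a b : A} (ha : HasVal σ ξ a)
    (hb : HasVal σ ξ b) : a = b := by
  obtain ⟨_, rfl⟩ := ha
  obtain ⟨_, rfl⟩ := hb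
  rfl

theorem isInit_iff {σ τ : BSeq κ A} :
    IsInit σ τ ↔ σ.len ≤ τ.len ∧ ∀ ξ a, HasVal σ ξ a → HasVal τ ξ a := by
  constructor
  · rintro ⟨h, hv⟩
    refine ⟨h, ?_⟩
    rintro ξ _ ⟨hξ, rfl⟩
    exact ⟨hξ.trans_le h, (hv ⟨ξ, hξ⟩).symm⟩
  · rintro ⟨h, hv⟩
    refine ⟨h, fun α => ?_⟩
    obtain ⟨_, h⟩ := hv α.1 _ ⟨α.2, rfl⟩
    exact h.symm

theorem IsInit.len_le {σ τ : BSeq κ A} (h : IsInit σ τ) : σ.len ≤ τ.len := h.1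

theorem IsInit.hasVal {σ τ : BSeq κ A} (h : IsInit σ τ) {ξ a} (hv : HasVal σ ξ a) :
    HasVal τ ξ a := (isInit_iff.1 h).2 ξ a hv

theorem IsInit.hasVal_of_lt {σ τ : BSeq κ A} (h : IsInit σ τ) {ξ a} (hv : HasVal τ ξ a)
    (hξ : ξ < σ.len) : HasVal σ ξ a := by
  obtain ⟨b, hb⟩ := exists_hasVal hξ
  rwa [hv.unique (h.hasVal hb)]

theorem IsInit.refl (σ : BSeq κ A) : IsInit σ σ := ⟨le_rfl, fun _ => rfl⟩

theorem IsInit.trans {σ τ υ : BSeq κ A} (h : IsInit σ τ) (h' : IsInit τ υ) : IsInit σ υ :=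
  isInit_iff.2 ⟨h.1.trans h'.1, fun _ _ hv => h'.hasVal (h.hasVal hv)⟩

theorem IsInit.eq_of_len_le {σ τ : BSeq κ A} (h : IsInit σ τ) (h' : τ.len ≤ σ.len) : σ = τ := by
  obtain ⟨l, hl, f⟩ := σ
  obtain ⟨m, hm, g⟩ := τ
  obtain ⟨h, hv⟩ := h
  obtain rfl : l = m := le_antisymm h h'
  congr
  exact funext hv

theorem IsInit.antisymm {σ τ : BSeq κ A} (h : IsInit σ τ) (h' : IsInit τ σ) : σ = τ :=
  h.eq_of_len_le h'.1

/-- Two initial segments of the same sequence are comparable. -/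
theorem IsInit.of_le {σ τ υ : BSeq κ A} (h : IsInit σ υ) (h' : IsInit τ υ)
    (hle : σ.len ≤ τ.len) : IsInit σ τ :=
  isInit_iff.2 ⟨hle, fun _ _ hv => h'.hasVal_of_lt (h.hasVal hv) (hv.1.trans_le hle)⟩

/-- The initial segment of `τ` of length `α`. -/
def BSeq.take (τ : BSeq κ A) (α : Ordinal.{u}) (h : α ≤ τ.len) : BSeq κ A where
  len := α
  len_lt := h.trans_lt τ.len_lt
  val ξ := τ.val ⟨ξ.1, lt_of_lt_of_le ξ.2 h⟩

theorem BSeq.isInit_take (τ : BSeq κ A) (α : Ordinal.{u}) (h : α ≤ τ.len) :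
    IsInit (τ.take α h) τ := ⟨h, fun _ => rfl⟩

theorem exists_bSeq_of_forall (l : Ordinal.{u}) (hl : l < κ.ord) {R : Ordinal.{u} → A → Prop}
    (hR : ∀ ξ < l, ∃ a, R ξ a) : ∃ τ : BSeq κ A, τ.len = l ∧ ∀ ξ a, HasVal τ ξ a → R ξ a := by
  choose f hf using hR
  refine ⟨⟨l, hl, fun ξ => f ξ.1 ξ.2⟩, rfl, ?_⟩
  rintro ξ _ ⟨h, rfl⟩
  exact hf ξ h

/-- A chain of sequences of bounded length has a union. -/
theorem exists_union {C : Set (BSeq κ A)} {μ : Ordinal.{u}} (hμ : μ < κ.ord)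
    (hlen : ∀ σ ∈ C, σ.len ≤ μ) (hC : ∀ σ ∈ C, ∀ τ ∈ C, IsInit σ τ ∨ IsInit τ σ) :
    ∃ τ : BSeq κ A, τ.len ≤ μ ∧ (∀ σ ∈ C, IsInit σ τ) ∧ ∀ ξ < τ.len, ∃ σ ∈ C, ξ < σ.len := by
  let L : Set Ordinal.{u} := BSeq.len '' C
  have hbdd : BddAbove L := ⟨μ, by rintro _ ⟨σ, hσ, rfl⟩; exact hlen σ hσ⟩
  have hle : sSup L ≤ μ := csSup_le' (by rintro _ ⟨σ, hσ, rfl⟩; exact hlen σ hσ)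
  have hcov : ∀ ξ < sSup L, ∃ σ ∈ C, ξ < σ.len := fun ξ hξ => by
    obtain ⟨_, ⟨σ, hσ, rfl⟩, h⟩ := (lt_csSup_iff' hbdd).1 hξ
    exact ⟨σ, hσ, h⟩
  obtain ⟨τ, hτ, hval⟩ := exists_bSeq_of_forall (κ := κ) (sSup L) (hle.trans_lt hμ)
    (R := fun ξ a => ∃ σ ∈ C, HasVal σ ξ a) fun ξ hξ => by
      obtain ⟨σ, hσ, h⟩ := hcov ξ hξ
      obtain ⟨a, ha⟩ := exists_hasVal h
      exact ⟨a, σ, hσ, ha⟩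
  refine ⟨τ, hτ.trans_le hle, fun σ hσ => isInit_iff.2 ?_, by rwa [hτ]⟩
  have hστ : σ.len ≤ τ.len := by
    rw [hτ]
    exact le_csSup hbdd ⟨σ, hσ, rfl⟩
  refine ⟨hστ, fun ξ a hv => ?_⟩
  obtain ⟨b, hb⟩ := exists_hasVal (hv.1.trans_le hστ)
  obtain ⟨σ', hσ', hb'⟩ := hval ξ b hb
  have hab : a = b := by
    rcases hC σ hσ σ' hσ' with h | h
    · exact (h.hasVal hv).unique hb'
    · exact hv.unique (h.hasVal hb')
  rwa [hab]

/-- In a family of sequences closed under unions, one-step extendability yields extensions of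
every length. -/
theorem exists_extension {G : Set (BSeq κ A)} {μ : Ordinal.{u}} (hμ : μ < κ.ord)
    (hlen : ∀ σ ∈ G, σ.len ≤ μ)
    (hunion : ∀ τ : BSeq κ A, τ.len ≤ μ → Order.IsSuccLimit τ.len →
      (∀ ξ < τ.len, ∃ σ ∈ G, IsInit σ τ ∧ ξ < σ.len) → τ ∈ G)
    (hext : ∀ σ ∈ G, σ.len < μ → ∃ τ ∈ G, IsInit σ τ ∧ σ.len < τ.len)
    {σ : BSeq κ A} (hσ : σ ∈ G) : ∃ τ ∈ G, IsInit σ τ ∧ τ.len = μ := by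
  have : Nonempty {τ : BSeq κ A // τ ∈ G ∧ IsInit σ τ} := ⟨⟨σ, hσ, .refl σ⟩⟩
  refine (exists_maximal_of_nonempty_chains_bounded
    (α := {τ : BSeq κ A // τ ∈ G ∧ IsInit σ τ}) (r := fun x y => IsInit x.1 y.1)
    (h := ?_) (trans := fun h h' => h.trans h')).elim ?_
  rotate_left
  · rintro ⟨τ, hτG, hστ⟩ hmax
    refine ⟨τ, hτG, hστ, (hlen τ hτG).eq_of_not_lt fun hlt => ?_⟩
    obtain ⟨υ, hυ, hτυ, hlt⟩ := hext τ hτG hlt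
    exact (hmax ⟨υ, hυ, hστ.trans hτυ⟩ hτυ).len_le.not_gt hlt
  · intro c hc ⟨y, hy⟩
    obtain ⟨τ, hτμ, hcτ, hcov⟩ := exists_union (C := Subtype.val '' c) hμ
      (by rintro _ ⟨x, _, rfl⟩; exact hlen x.1 x.2.1)
      (by
        rintro _ ⟨x, hx, rfl⟩ _ ⟨z, hz, rfl⟩
        by_cases h : x = z
        · exact h ▸ .inl (.refl _)
        · exact hc hx hz h)
    have hcτ' : ∀ x ∈ c, IsInit x.1 τ := fun x hx => hcτ _ ⟨x, hx, rfl⟩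
    have hcov' : ∀ ξ < τ.len, ∃ x ∈ c, ξ < x.1.len := fun ξ hξ => by
      obtain ⟨_, ⟨x, hx, rfl⟩, h⟩ := hcov ξ hξ
      exact ⟨x, hx, h⟩
    have hτG : τ ∈ G := by
      -- Either the union is already a member of the chain, or its length is a limit and closure
      -- under unions applies.
      by_cases h : ∃ x ∈ c, τ.len ≤ x.1.len
      · obtain ⟨x, hx, h⟩ := h
        rw [← (hcτ' x hx).eq_of_len_le h]
        exact x.2.1
      · push Not at h
        have hlim : Order.IsSuccLimit τ.len := by
          refine ⟨fun hmin => (h y hy).not_ge (hmin.isBot _),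
            Order.isSuccPrelimit_of_succ_lt fun ξ hξ => ?_⟩
          obtain ⟨x, hx, hlt⟩ := hcov' ξ hξ
          exact (Order.succ_le_of_lt hlt).trans_lt (h x hx)
        refine hunion τ hτμ hlim fun ξ hξ => ?_
        obtain ⟨x, hx, hlt⟩ := hcov' ξ hξ
        exact ⟨x.1, x.2.1, hcτ' x hx, hlt⟩
    exact ⟨⟨τ, hτG, y.2.2.trans (hcτ' y hy)⟩, hcτ'⟩

end Sequences

/-! ### Building nodes of Laver trees: blocks and coding. -/

section Trees

variable {κ : Cardinal.{u}} {T : Set (Node κ)}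

/-- The initial segments of τ, indexed by their lengths, form an increasing sequence of limit length
with union τ. -/
theorem IsLimitClosed.mem_of_forall_lt (hT : IsTree T) (hT' : IsLimitClosed T) {τ : Node κ}
    (hlim : Order.IsSuccLimit τ.len)
    (h : ∀ ξ < τ.len, ∃ σ ∈ T, IsInit σ τ ∧ ξ < σ.len) : τ ∈ T := by
  have hle : ∀ α : Set.Iio τ.len, α.1 ≤ τ.len := fun α => le_of_lt α.2
  refine hT' τ.len hlim τ.len_lt (fun α => τ.take α.1 (hle α)) (fun α => ?_)
    (fun α β h => ?_) τ ⟨fun α => τ.isInit_take _ _, fun ξ hξ => ?_⟩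
  · obtain ⟨σ, hσ, hστ, hlt⟩ := h α.1 α.2
    exact hT σ hσ _ ((τ.isInit_take _ _).of_le hστ hlt.le)
  · exact (τ.isInit_take _ _).of_le (τ.isInit_take _ _) h
  · exact ⟨⟨Order.succ ξ, hlim.succ_lt hξ⟩, Order.lt_succ ξ⟩

theorem exists_hasVal_of_mem_succSet {σ : Node κ} {β : Below κ} (h : β ∈ succSet T σ) :
    ∃ τ ∈ T, IsInit σ τ ∧ τ.len = Order.succ σ.len ∧ HasVal τ σ.len β := h

/-- Every node above the stem of `T` has extensions in `T` of every larger length. -/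
theorem exists_mem_len_eq (hκ : κ.IsRegular) (hT : IsTree T) (hT' : IsLimitClosed T) {ρ : Node κ}
    (hsucc : ∀ σ ∈ T, IsInit ρ σ → Cardinal.mk (succSet T σ) = Cardinal.lift.{u + 1} κ)
    {σ : Node κ} (hσ : σ ∈ T) (hρσ : IsInit ρ σ) {μ : Ordinal.{u}} (hμ : μ < κ.ord)
    (hle : σ.len ≤ μ) : ∃ τ ∈ T, IsInit σ τ ∧ τ.len = μ := by
  refine (exists_extension (G := {τ | τ ∈ T ∧ IsInit ρ τ ∧ τ.len ≤ μ}) hμ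
    (fun σ hσ => hσ.2.2) (fun τ hτμ hlim hcov => ?_) (fun σ hσ hlt => ?_)
    (σ := σ) ⟨hσ, hρσ, hle⟩).imp fun τ hτ => ⟨hτ.1.1, hτ.2⟩
  · refine ⟨hT'.mem_of_forall_lt hT hlim fun ξ hξ => ?_, ?_, hτμ⟩
    · obtain ⟨σ, hσ, h⟩ := hcov ξ hξ
      exact ⟨σ, hσ.1, h⟩
    · obtain ⟨σ, hσ, h, _⟩ := hcov 0 hlim.bot_lt
      exact hσ.2.1.trans h
  · obtain ⟨a⟩ := nonempty_below hκ
    obtain ⟨β, hβ, _⟩ := exists_gt_of_mk_eq hκ (hsucc σ hσ.1 hσ.2.1) a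
    obtain ⟨τ, hτ, hστ, hlen, _⟩ := exists_hasVal_of_mem_succSet hβ
    exact ⟨τ, ⟨hτ, hσ.2.1.trans hστ, hlen.trans_le (Order.succ_le_of_lt hlt)⟩, hστ,
      hlen ▸ Order.lt_succ _⟩

/-- The supremum of the block `σ(ω·η), σ(ω·η+1), …` is `δ`. -/
def BlockSup (σ : Node κ) (η δ : Ordinal.{u}) : Prop :=
  Ordinal.omega0 * η + Ordinal.omega0 ≤ σ.len ∧
    IsLUB {γ | ∃ (n : ℕ) (a : Below κ), HasVal σ (Ordinal.omega0 * η + n) a ∧ a.1 = γ} δ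

theorem exists_blockSup {σ : Node κ} {η : Ordinal.{u}}
    (h : Ordinal.omega0 * η + Ordinal.omega0 ≤ σ.len) : ∃ δ, BlockSup σ η δ :=
  ⟨_, h, isLUB_csSup'
    ⟨κ.ord, by rintro _ ⟨n, a, _, rfl⟩; exact le_of_lt a.2⟩⟩

theorem BlockSup.unique {σ : Node κ} {η δ δ' : Ordinal.{u}} (h : BlockSup σ η δ)
    (h' : BlockSup σ η δ') : δ = δ' := h.2.unique h'.2

theorem BlockSup.mono {σ τ : Node κ} {η δ : Ordinal.{u}} (h : BlockSup σ η δ)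
    (hστ : IsInit σ τ) : BlockSup τ η δ := by
  refine ⟨h.1.trans hστ.len_le, ?_⟩
  have hval : ∀ (n : ℕ) a, HasVal τ (Ordinal.omega0 * η + n) a ↔
      HasVal σ (Ordinal.omega0 * η + n) a := fun n a => ⟨fun hv => hστ.hasVal_of_lt hv
    ((add_lt_add_right (Ordinal.natCast_lt_omega0 _) _).trans_le h.1),
    hστ.hasVal⟩
  simp only [hval]
  exact h.2

/-- The bit of `φ(x)` at position `η` determined by the initial segment `σ` of `x`. -/
def Codes (S : Set (Below κ)) (σ : Node κ) (η : Ordinal.{u}) (b : Bool) : Prop :=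
  ∃ δ, BlockSup σ η δ ∧ (b = true ↔ ∃ β ∈ S, β.1 = δ)

theorem Codes.mono {S : Set (Below κ)} {σ τ : Node κ} {η : Ordinal.{u}} {b : Bool}
    (h : Codes S σ η b) (hστ : IsInit σ τ) : Codes S τ η b := by
  obtain ⟨δ, hδ, hb⟩ := h
  exact ⟨δ, hδ.mono hστ, hb⟩

theorem Codes.unique {S : Set (Below κ)} {σ : Node κ} {η : Ordinal.{u}} {b b' : Bool}
    (h : Codes S σ η b) (h' : Codes S σ η b') : b = b' := by
  obtain ⟨δ, hδ, hb⟩ := h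
  obtain ⟨δ', hδ', hb'⟩ := h'
  obtain rfl := hδ.unique hδ'
  exact Bool.eq_iff_iff.2 (hb.trans hb'.symm)

theorem exists_codes (S : Set (Below κ)) {σ : Node κ} {η : Ordinal.{u}}
    (h : Ordinal.omega0 * η + Ordinal.omega0 ≤ σ.len) : ∃ b, Codes S σ η b := by
  classical
  obtain ⟨δ, hδ⟩ := exists_blockSup h
  exact ⟨decide (∃ β ∈ S, β.1 = δ), δ, hδ, by simp⟩

/-- Above the stem, a block can be appended whose supremum lies in a given stationary set of
ordinals of cofinality `ω`. -/
theorem exists_block (hκ : κ.IsRegular) (hκ' : Cardinal.aleph0 < κ) (hT : IsTree T)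
    (hT' : IsLimitClosed T) {ρ : Node κ}
    (hsucc : ∀ σ ∈ T, IsInit ρ σ → Cardinal.mk (succSet T σ) = Cardinal.lift.{u + 1} κ)
    {S : Set (Below κ)} (hS : IsStationary S) (hcof : S ⊆ cofOmega κ)
    {σ : Node κ} (hσ : σ ∈ T) (hρσ : IsInit ρ σ) :
    ∃ τ ∈ T, IsInit σ τ ∧ τ.len = σ.len + Ordinal.omega0 ∧ ∃ β ∈ S,
      IsLUB {γ | ∃ (n : ℕ) (a : Below κ), HasVal τ (σ.len + n) a ∧ a.1 = γ} β.1 := by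
  have hstep : ∀ (τ : Node κ) (ξ : Below κ), ∃ (υ : Node κ) (β : Below κ), τ ∈ T → IsInit ρ τ →
      υ ∈ T ∧ IsInit τ υ ∧ υ.len = Order.succ τ.len ∧ HasVal υ τ.len β ∧ ξ < β := fun τ ξ => by
    by_cases h : τ ∈ T ∧ IsInit ρ τ
    · obtain ⟨β, hβ, hξβ⟩ := exists_gt_of_mk_eq hκ (hsucc τ h.1 h.2) ξ
      obtain ⟨υ, hυ⟩ := exists_hasVal_of_mem_succSet hβ
      exact ⟨υ, β, fun _ _ => ⟨hυ.1, hυ.2.1, hυ.2.2.1, hυ.2.2.2, hξβ⟩⟩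
    · exact ⟨τ, ξ, fun h₁ h₂ => (h ⟨h₁, h₂⟩).elim⟩
  choose N B hNB using hstep
  -- the node reached from `σ` when the lower bounds listed in `l` (latest first) are used
  let R : List (Below κ) → Node κ := fun l => l.foldr (fun ξ τ => N τ ξ) σ
  have hR : ∀ l, R l ∈ T ∧ IsInit σ (R l) := fun l => by
    induction l with
    | nil => exact ⟨hσ, .refl σ⟩
    | cons ξ l ih =>
      have h := hNB (R l) ξ ih.1 (hρσ.trans ih.2)
      exact ⟨h.1, ih.2.trans h.2.1⟩
  obtain ⟨b⟩ := nonempty_below hκ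
  let F : List (Below κ) → Below κ := fun l => match l with
    | [] => b
    | ξ :: l => B (R l) ξ
  obtain ⟨δ, hδS, hδ⟩ := hS (isClub_closedUnder hκ hκ' F)
  obtain ⟨a, haδ, ha⟩ := exists_ladder (hcof hδS)
  -- The first n rungs of the ladder, latest first, so that `R (L n)` is the node after n rounds.
  let L : ℕ → List (Below κ) := fun n => Nat.rec [] (fun n l => a n :: l) n
  have hL : ∀ n, ∀ x ∈ L n, x < δ := fun n => by
    induction n with
    | zero => simp [L]
    | succ n ih =>
      intro x hx
      rcases List.mem_cons.1 hx with rfl | hx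
      · exact haδ n
      · exact ih x hx
  have hsuccN : ∀ n, R (L (n + 1)) ∈ T ∧ IsInit (R (L n)) (R (L (n + 1))) ∧
      (R (L (n + 1))).len = Order.succ (R (L n)).len ∧
      HasVal (R (L (n + 1))) (R (L n)).len (B (R (L n)) (a n)) ∧ a n < B (R (L n)) (a n) :=
    fun n => hNB (R (L n)) (a n) (hR _).1 (hρσ.trans (hR _).2)
  -- `L (n + 1)` is a finite list below δ, and `F` evaluated on it is the n-th entry, so closure of
  -- δ applies.
  have hBδ : ∀ n, B (R (L n)) (a n) < δ := fun n => hδ (L (n + 1)) (hL (n + 1))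
  have hlen : ∀ n : ℕ, (R (L n)).len = σ.len + n := fun n => by
    induction n with
    | zero => simp [R, L]
    | succ n ih =>
      rw [(hsuccN n).2.2.1, ih, Nat.cast_succ, ← add_assoc, Order.succ_eq_add_one]
  have hmono : ∀ m n, m ≤ n → IsInit (R (L m)) (R (L n)) := fun m n h => by
    induction n, h using Nat.le_induction with
    | base => exact .refl _
    | succ n _ ih => exact ih.trans (hsuccN n).2.1
  have hμ : σ.len + Ordinal.omega0 < κ.ord :=
    Ordinal.isPrincipal_add_ord hκ.aleph0_le σ.len_lt
      (by rw [← Cardinal.ord_aleph0]; exact Cardinal.ord_lt_ord.2 hκ')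
  obtain ⟨τ, hτμ, hτ, hcov⟩ := exists_union (C := Set.range fun n => R (L n)) hμ
    (by
      rintro _ ⟨n, rfl⟩
      exact (hlen n).trans_le (add_le_add_right (Ordinal.natCast_lt_omega0 n).le _))
    (by
      rintro _ ⟨m, rfl⟩ _ ⟨n, rfl⟩
      exact (le_total m n).imp (hmono m n) (hmono n m))
  have hτ' : ∀ n, IsInit (R (L n)) τ := fun n => hτ _ ⟨n, rfl⟩
  have hτlen : τ.len = σ.len + Ordinal.omega0 := by
    refine le_antisymm hτμ (le_of_forall_lt fun ξ hξ => ?_)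
    obtain ⟨_, hm, hξ⟩ := (Ordinal.lt_add_iff Ordinal.omega0_ne_zero).1 hξ
    obtain ⟨n, rfl⟩ := Ordinal.lt_omega0.1 hm
    refine hξ.trans_lt (lt_of_lt_of_le ?_ (hτ' (n + 1)).len_le)
    rw [hlen (n + 1)]
    exact add_lt_add_right (by exact_mod_cast Nat.lt_succ_self n) _
  have hlim : Order.IsSuccLimit τ.len := by
    rw [hτlen]
    exact Ordinal.isSuccLimit_add _ Ordinal.isSuccLimit_omega0
  have hval : ∀ n : ℕ, HasVal τ (σ.len + n) (B (R (L n)) (a n)) := fun n => by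
    rw [← hlen]
    exact (hτ' (n + 1)).hasVal (hsuccN n).2.2.2.1
  refine ⟨τ, hT'.mem_of_forall_lt hT hlim fun ξ hξ => ?_, by simpa [R, L] using hτ' 0, hτlen, δ,
    hδS, ?_, fun γ hγ => ?_⟩
  · obtain ⟨_, ⟨n, rfl⟩, h⟩ := hcov ξ hξ
    exact ⟨_, (hR _).1, hτ' n, h⟩
  · rintro _ ⟨n, x, hx, rfl⟩
    rw [hx.unique (hval n)]
    exact (hBδ n).le
  · refine le_of_forall_lt fun ξ hξ => ?_
    obtain ⟨n, hn⟩ := ha ⟨ξ, hξ.trans δ.2⟩ hξ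
    exact (Subtype.coe_lt_coe.2 (hn.trans_lt (hsuccN n).2.2.2.2)).trans_le (hγ ⟨n, _, hval n, rfl⟩)

/-- Above the stem, a node whose length is a multiple of `ω` can be extended so as to code any
given extension of the sequence of bits that it codes. -/
theorem exists_coding (hκ : κ.IsRegular) (hκ' : Cardinal.aleph0 < κ) (hT : IsTree T)
    (hT' : IsLimitClosed T) {ρ : Node κ}
    (hsucc : ∀ σ ∈ T, IsInit ρ σ → Cardinal.mk (succSet T σ) = Cardinal.lift.{u + 1} κ)
    {S₀ S₁ : Set (Below κ)} (hcof : S₀ ∪ S₁ = cofOmega κ) (hdisj : Disjoint S₀ S₁)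
    (hS₀ : IsStationary S₀) (hS₁ : IsStationary S₁)
    {σ : Node κ} (hσ : σ ∈ T) (hρσ : IsInit ρ σ) {α : Ordinal.{u}}
    (hlen : σ.len = Ordinal.omega0 * α) {t : BSeq κ Bool} (hαt : α ≤ t.len)
    (hcodes : ∀ η < α, ∀ b, HasVal t η b → Codes S₁ σ η b) :
    ∃ τ ∈ T, IsInit σ τ ∧ ∀ η b, HasVal t η b → Codes S₁ τ η b := by
  have hω : Ordinal.omega0 < κ.ord := by
    rw [← Cardinal.ord_aleph0]; exact Cardinal.ord_lt_ord.2 hκ'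
  have hμ : Ordinal.omega0 * t.len < κ.ord :=
    Ordinal.isPrincipal_mul_ord hκ.aleph0_le hω t.len_lt
  have hbit : ∀ (b : Bool) (τ : Node κ), τ ∈ T → IsInit ρ τ →
      ∃ υ ∈ T, IsInit τ υ ∧ υ.len = τ.len + Ordinal.omega0 ∧ ∃ β : Below κ,
        IsLUB {γ | ∃ (n : ℕ) (a : Below κ), HasVal υ (τ.len + n) a ∧ a.1 = γ} β.1 ∧
        (b = true ↔ β ∈ S₁) := fun b τ hτ hρτ => by
    cases b with
    | false =>
      obtain ⟨υ, h₁, h₂, h₃, β, hβ, h₄⟩ := exists_block hκ hκ' hT hT' hsucc hS₀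
        (hcof ▸ Set.subset_union_left) hτ hρτ
      exact ⟨υ, h₁, h₂, h₃, β, h₄, by simpa using Set.disjoint_left.1 hdisj hβ⟩
    | true =>
      obtain ⟨υ, h₁, h₂, h₃, β, hβ, h₄⟩ := exists_block hκ hκ' hT hT' hsucc hS₁
        (hcof ▸ Set.subset_union_right) hτ hρτ
      exact ⟨υ, h₁, h₂, h₃, β, h₄, by simpa using hβ⟩
  -- Restricting to lengths ω·ξ ensures that only whole blocks are added and that a node of length
  -- ω·|t| codes all of t.
  refine (exists_extension
    (G := {τ | τ ∈ T ∧ IsInit ρ τ ∧ ∃ ξ ≤ t.len, τ.len = Ordinal.omega0 * ξ ∧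
      ∀ η < ξ, ∀ b, HasVal t η b → Codes S₁ τ η b}) hμ ?_ ?_ ?_
    (σ := σ) ⟨hσ, hρσ, α, hαt, hlen, hcodes⟩).elim ?_
  rotate_right
  · rintro τ ⟨⟨hτ, -, ξ, -, hτξ, hτc⟩, hστ, hτlen⟩
    obtain rfl : t.len = ξ :=
      mul_left_cancel₀ Ordinal.omega0_ne_zero (hτlen.symm.trans hτξ)
    exact ⟨τ, hτ, hστ, fun η b hb => hτc η hb.1 b hb⟩
  · rintro τ ⟨-, -, ξ, hξ, h, -⟩
    exact h.trans_le (mul_le_mul_right hξ _)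
  · intro τ hτμ hlim hcov
    obtain ⟨ξ, hξ⟩ := Ordinal.isSuccPrelimit_iff_omega0_dvd.1 hlim.isSuccPrelimit
    refine ⟨hT'.mem_of_forall_lt hT hlim fun ζ hζ => ?_, ?_, ξ, ?_, hξ, fun η hη b hb => ?_⟩
    · obtain ⟨υ, hυ, h⟩ := hcov ζ hζ
      exact ⟨υ, hυ.1, h⟩
    · obtain ⟨υ, hυ, h, -⟩ := hcov 0 hlim.bot_lt
      exact hυ.2.1.trans h
    · rw [hξ] at hτμ
      exact le_of_mul_le_mul_left hτμ Ordinal.omega0_pos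
    -- A member longer than ω·η has length ω·ζ with η < ζ, so it already codes bit η.
    · obtain ⟨υ, ⟨-, -, ζ, -, hζ, hc⟩, h, hlt⟩ := hcov (Ordinal.omega0 * η)
        (by rw [hξ]; exact mul_lt_mul_of_pos_left hη Ordinal.omega0_pos)
      rw [hζ] at hlt
      exact (hc η (lt_of_mul_lt_mul_left hlt zero_le) b hb).mono h
  · rintro τ ⟨hτ, hρτ, ξ, hξ, hτξ, hc⟩ hlt
    rw [hτξ] at hlt
    have hξt : ξ < t.len := lt_of_mul_lt_mul_left hlt zero_le
    obtain ⟨b, hb⟩ := exists_hasVal hξt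
    obtain ⟨υ, hυ, hτυ, hυlen, β, hβ, hbβ⟩ := hbit b τ hτ hρτ
    rw [hτξ] at hυlen hβ
    refine ⟨υ, ⟨hυ, hρτ.trans hτυ, Order.succ ξ, Order.succ_le_of_lt hξt,
      by rw [hυlen, Ordinal.mul_succ], fun η hη b' hb' => ?_⟩, hτυ, ?_⟩
    · rcases (Order.lt_succ_iff.1 hη).lt_or_eq with h | rfl
      · exact (hc η h b' hb').mono hτυ
      · rw [hb'.unique hb]
        refine ⟨β.1, ⟨hυlen.ge, hβ⟩, hbβ.trans ⟨fun h => ⟨β, h, rfl⟩, ?_⟩⟩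
        rintro ⟨β', h, h'⟩
        exact Subtype.ext h' ▸ h
    · rw [hτξ, hυlen]
      exact lt_add_of_pos_right _ Ordinal.omega0_pos

end Trees

/-! ### Forced equality of names. -/

section Names

variable {P : Type w} [Preorder P]

theorem DenseBelow.imp {p : P} {D E : P → Prop} (h : DenseBelow p D) (hDE : ∀ q ≤ p, D q → E q) :
    DenseBelow p E := fun q hq => by
  obtain ⟨r, hr, hD⟩ := h q hq
  exact ⟨r, hr, hDE r (hr.trans hq) hD⟩

theorem denseBelow_of_forall {p : P} {D : P → Prop} (h : ∀ q ≤ p, D q) : DenseBelow p D :=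
  fun q hq => ⟨q, le_rfl, h q hq⟩

/-- Two formulas of which the first is preserved by stronger conditions meet below `p`. -/
theorem DenseBelow.exists_and {p : P} {D E : P → Prop} (hD : DenseBelow p D)
    (hE : DenseBelow p E) (hmono : ∀ q r, r ≤ q → D q → D r) : ∃ q ≤ p, D q ∧ E q := by
  obtain ⟨q, hq, hDq⟩ := hD p le_rfl
  obtain ⟨r, hr, hEr⟩ := hE q hq
  exact ⟨r, hr.trans hq, hmono q r hr hDq, hEr⟩

theorem fEq_mk {ι ι' : Type w} {A : ι → PName P} {a : ι → P} {B : ι' → PName P} {b : ι' → P}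
    {p : P} : fEq (.mk ι A a) (.mk ι' B b) p ↔
    (∀ i : ι, ∀ q ≤ p, q ≤ a i → DenseBelow q fun r => ∃ j : ι', r ≤ b j ∧ fEq (A i) (B j) r) ∧
    (∀ j : ι', ∀ q ≤ p, q ≤ b j → DenseBelow q fun r => ∃ i : ι, r ≤ a i ∧ fEq (A i) (B j) r) := by
  rw [fEq]

theorem fMem_mk {x : PName P} {ι : Type w} {B : ι → PName P} {b : ι → P} {p : P} :
    fMem x (.mk ι B b) p ↔ DenseBelow p fun q => ∃ j : ι, q ≤ b j ∧ fEq x (B j) q := Iff.rfl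

theorem fEq_mono {x y : PName P} {p q : P} (h : fEq x y p) (hqp : q ≤ p) : fEq x y q := by
  cases x
  cases y
  rw [fEq_mk] at h ⊢
  exact ⟨fun i r hr => h.1 i r (hr.trans hqp), fun j r hr => h.2 j r (hr.trans hqp)⟩

theorem fEq_refl (x : PName P) (p : P) : fEq x x p := by
  induction x generalizing p with
  | mk ι A a ih =>
    rw [fEq_mk]
    exact ⟨fun i q _ hqa => denseBelow_of_forall fun r hr => ⟨i, hr.trans hqa, ih i r⟩,
      fun i q _ hqa => denseBelow_of_forall fun r hr => ⟨i, hr.trans hqa, ih i r⟩⟩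

theorem fEq_symm {x y : PName P} {p : P} (h : fEq x y p) : fEq y x p := by
  induction x generalizing y p with
  | mk ι A a ih =>
    obtain ⟨ι', B, b⟩ := y
    rw [fEq_mk] at h ⊢
    exact ⟨fun j q hq hqb => (h.2 j q hq hqb).imp fun r _ ⟨i, hi, he⟩ => ⟨i, hi, ih i he⟩,
      fun i q hq hqa => (h.1 i q hq hqa).imp fun r _ ⟨j, hj, he⟩ => ⟨j, hj, ih i he⟩⟩

/-- Each of the four members finds its match only densely, so the condition is strengthened four
times. This weak decoding is enough because equality of ordinal names does not depend on the
condition. -/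
theorem fEq_upairName {x y z w : PName P} {p : P} (h : fEq (upairName x y) (upairName z w) p) :
    ∃ q ≤ p, (fEq x z q ∨ fEq x w q) ∧ (fEq y z q ∨ fEq y w q) ∧
      (fEq x z q ∨ fEq y z q) ∧ (fEq x w q ∨ fEq y w q) := by
  rw [upairName, upairName, fEq_mk] at h
  obtain ⟨h₁, h₂⟩ := h
  obtain ⟨q₁, hq₁, ⟨b₁, _⟩, -, e₁⟩ := h₁ (true, p) p le_rfl le_rfl p le_rfl
  obtain ⟨q₂, hq₂, ⟨b₂, _⟩, -, e₂⟩ := h₁ (false, p) q₁ hq₁ hq₁ q₁ le_rfl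
  obtain ⟨q₃, hq₃, ⟨b₃, _⟩, -, e₃⟩ := h₂ (true, p) q₂ (hq₂.trans hq₁) (hq₂.trans hq₁) q₂ le_rfl
  obtain ⟨q₄, hq₄, ⟨b₄, _⟩, -, e₄⟩ := h₂ (false, p) q₃ (hq₃.trans (hq₂.trans hq₁))
    (hq₃.trans (hq₂.trans hq₁)) q₃ le_rfl
  replace e₁ := fEq_mono e₁ (hq₄.trans (hq₃.trans hq₂))
  replace e₂ := fEq_mono e₂ (hq₄.trans hq₃)
  replace e₃ := fEq_mono e₃ hq₄
  refine ⟨q₄, hq₄.trans (hq₃.trans (hq₂.trans hq₁)), ?_, ?_, ?_, ?_⟩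
  · cases b₁ <;> simp_all
  · cases b₂ <;> simp_all
  · cases b₃ <;> simp_all
  · cases b₄ <;> simp_all

end Names

/-! ### Names for ordinals and for functions between ordinals. -/

section Ordinals

variable {P : Type (u + 1)} [Preorder P]

theorem fEq_ordName {α β : Ordinal.{u}} {p : P} : fEq (ordName α) (ordName β) p ↔ α = β := by
  constructor
  · have key : ∀ α β : Ordinal.{u}, ∀ p : P, fEq (ordName α) (ordName β) p → ¬ α < β := by
      intro α
      induction α using WellFoundedLT.induction with
      | ind α ih =>
        intro β p h hlt
        rw [ordName, ordName, fEq_mk] at h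
        obtain ⟨q, hq, ⟨⟨γ, hγ⟩, _⟩, -, he⟩ := h.2 (⟨α, hlt⟩, p) p le_rfl le_rfl p le_rfl
        exact ih γ hγ α q he hγ
    exact fun h => le_antisymm (not_lt.1 (key β α p (fEq_symm h))) (not_lt.1 (key α β p h))
  · rintro rfl
    exact fEq_refl _ _

theorem fEq_pairName_ordName {α β γ δ : Ordinal.{u}} {p : P} :
    fEq (pairName (ordName α) (ordName β)) (pairName (ordName γ) (ordName δ)) p ↔
      α = γ ∧ β = δ := by
  constructor
  · intro h
    have key : ∀ {a b c d : Ordinal.{u}} {q : P},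
        fEq (upairName (ordName a) (ordName b)) (upairName (ordName c) (ordName d)) q →
        (a = c ∨ a = d) ∧ (b = c ∨ b = d) ∧ (a = c ∨ b = c) ∧ (a = d ∨ b = d) := fun h => by
      obtain ⟨r, -, h⟩ := fEq_upairName h
      simpa only [fEq_ordName] using h
    obtain ⟨q, -, h₁, h₂, h₃, h₄⟩ := fEq_upairName h
    have h₁ := h₁.imp key key
    have h₂ := h₂.imp key key
    have h₃ := h₃.imp key key
    have h₄ := h₄.imp key key
    grind
  · rintro ⟨rfl, rfl⟩
    exact fEq_refl _ _

/-- The value of a name consisting of pairs of ordinals. -/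
theorem fApp_mk {ι : Type (u + 1)} {a b : ι → Ordinal.{u}} {c : ι → P} {α β : Ordinal.{u}} {p : P} :
    fApp (.mk ι (fun i => pairName (ordName (a i)) (ordName (b i))) c) α β p ↔
      DenseBelow p fun q => ∃ i, q ≤ c i ∧ a i = α ∧ b i = β := by
  simp only [fApp, fMem_mk, fEq_pairName_ordName, eq_comm]

/-- A name consisting of pairs of ordinals is forced to be a function from `δ` to `ε` as soon as
it is total and single-valued. -/
theorem fFun_mk {ι : Type (u + 1)} {a b : ι → Ordinal.{u}} {c : ι → P} {δ ε : Ordinal.{u}}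
    (ha : ∀ i, a i < δ) (hb : ∀ i, b i < ε) {p : P}
    (htotal : ∀ α < δ, DenseBelow p fun q => ∃ i, q ≤ c i ∧ a i = α)
    (hunique : ∀ i j, ∀ q ≤ p, q ≤ c i → q ≤ c j → a i = a j → b i = b j) :
    fFun (.mk ι (fun i => pairName (ordName (a i)) (ordName (b i))) c) δ ε p := by
  refine ⟨fun z q _ hz => DenseBelow.imp hz ?_, fun α => ?_, fun α β γ q hq h => ?_⟩
  · rintro r - ⟨i, -, hi⟩
    exact ⟨⟨a i, ha i⟩, denseBelow_of_forall fun s hs => ⟨⟨b i, hb i⟩, fEq_mono hi hs⟩⟩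
  · refine (htotal α.1 α.2).imp ?_
    rintro q - ⟨i, hi, hα⟩
    exact ⟨⟨b i, hb i⟩, fApp_mk.2 (denseBelow_of_forall fun r hr => ⟨i, hr.trans hi, hα, rfl⟩)⟩
  · obtain ⟨r, hr, ⟨i, hi, hiα, hiβ⟩, ⟨j, hj, hjα, hjγ⟩⟩ :=
      (fApp_mk.1 h.1).exists_and (fApp_mk.1 h.2)
        fun q r hrq ⟨i, hi, h⟩ => ⟨i, hrq.trans hi, h⟩
    rw [← hiβ, ← hjγ, hunique i j r (hr.trans hq) hi hj (hiα.trans hjα.symm)]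
    exact fEq_refl _ _

theorem fBlockSup_mono {x : PName P} {α β : Ordinal.{u}} {p q : P} (h : fBlockSup x α β p)
    (hqp : q ≤ p) : fBlockSup x α β q :=
  ⟨fun n γ r hr => h.1 n γ r (hr.trans hqp), fun δ r hr => h.2 δ r (hr.trans hqp)⟩

end Ordinals

/-! ### Stems of Laver trees. -/

section Stems

variable {κ : Cardinal.{u}} {T T' : Set (Node κ)}

theorem IsStem.unique {σ τ : Node κ} (h : IsStem T σ) (h' : IsStem T τ) : σ = τ :=
  (h'.2.2 σ h.1 h.2.1).antisymm (h.2.2 τ h'.1 h'.2.1)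

theorem IsLaverTree.exists_isStem (hT : IsLaverTree T) : ∃ ρ, IsStem T ρ :=
  hT.2.2.imp fun _ h => h.1

theorem IsLaverTree.mk_succSet (hT : IsLaverTree T) {ρ : Node κ} (hρ : IsStem T ρ) :
    ∀ σ ∈ T, IsInit ρ σ → Cardinal.mk (succSet T σ) = Cardinal.lift.{u + 1} κ := by
  obtain ⟨ρ', hρ', h⟩ := hT.2.2
  rwa [hρ'.unique hρ] at h

theorem IsLaverTree.exists_mem_len_eq (hκ : κ.IsRegular) (hT : IsLaverTree T) {ρ : Node κ}
    (hρ : IsStem T ρ) {μ : Ordinal.{u}} (hμ : μ < κ.ord) (hle : ρ.len ≤ μ) :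
    ∃ τ ∈ T, IsInit ρ τ ∧ τ.len = μ :=
  LaverForcing.exists_mem_len_eq hκ hT.1 hT.2.1 (hT.mk_succSet hρ) hρ.1 (.refl ρ) hμ hle

/-- A node of the smaller tree at least as long as the old stem must extend it, so the old stem is
in the smaller tree and is still comparable with all its nodes. -/
theorem IsStem.isInit_of_subset (hκ : κ.IsRegular) (hT' : IsLaverTree T') (hsub : T' ⊆ T)
    {ρ ρ' : Node κ} (hρ : IsStem T ρ) (hρ' : IsStem T' ρ') : IsInit ρ ρ' := by
  obtain ⟨τ, hτ, -, hlen⟩ := hT'.exists_mem_len_eq hκ hρ' (max_lt ρ.len_lt ρ'.len_lt)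
    (le_max_right _ _)
  have hρτ : IsInit ρ τ := by
    rcases hρ.2.1 τ (hsub hτ) with h | h
    · exact h
    · rw [h.eq_of_len_le (hlen ▸ le_max_left _ _)]
      exact .refl ρ
  exact hρ'.2.2 ρ (hT'.1 τ hτ ρ hρτ) fun υ hυ => hρ.2.1 υ (hsub hυ)

/-- σ splits into several successors, so a node properly extending σ is incomparable with one of
them. -/
theorem IsLaverTree.isStem_restrict (hκ : κ.IsRegular) (hT : IsLaverTree T) {ρ σ : Node κ}
    (hρ : IsStem T ρ) (hσ : σ ∈ T) (hρσ : IsInit ρ σ) : IsStem (restrict T σ) σ := by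
  refine ⟨⟨hσ, .inl (.refl σ)⟩, fun τ hτ => hτ.2, fun υ hυ hcomp => ?_⟩
  rcases hυ.2 with h | h
  swap
  · exact h
  rcases h.len_le.lt_or_eq with hlt | heq
  swap
  · rw [h.eq_of_len_le heq.ge]
    exact .refl υ
  obtain ⟨b, hb⟩ := exists_hasVal hlt
  obtain ⟨β, hβ, hbβ⟩ := exists_gt_of_mk_eq hκ (hT.mk_succSet hρ σ hσ hρσ) b
  obtain ⟨τ, hτ, hστ, hlen, hval⟩ := exists_hasVal_of_mem_succSet hβ
  refine (hbβ.ne ?_).elim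
  rcases hcomp τ ⟨hτ, .inl hστ⟩ with h' | h'
  · exact (h'.hasVal hb).unique hval
  · exact hb.unique (h'.hasVal hval)

end Stems

/-! ### The generic real and the Cohen real coded by it. -/

section Generic

variable {κ : Cardinal.{u}} {P : Set (Set (Node κ))}

theorem exists_le_isStem (hκ : κ.IsRegular) (hLaver : ∀ T ∈ P, IsLaverTree T)
    (hrestrict : ∀ T ∈ P, ∀ σ ∈ T, restrict T σ ∈ P) {p : P} {ρ σ : Node κ}
    (hρ : IsStem p.1 ρ) (hσ : σ ∈ p.1) (hρσ : IsInit ρ σ) : ∃ q ≤ p, IsStem q.1 σ :=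
  ⟨⟨restrict p.1 σ, hrestrict p.1 p.2 σ hσ⟩, fun _ h => h.1,
    (hLaver p.1 p.2).isStem_restrict hκ hρ hσ hρσ⟩

theorem exists_le_isStem_len (hκ : κ.IsRegular) (hLaver : ∀ T ∈ P, IsLaverTree T)
    (hrestrict : ∀ T ∈ P, ∀ σ ∈ T, restrict T σ ∈ P) (p : P) {μ : Ordinal.{u}}
    (hμ : μ < κ.ord) : ∃ q ≤ p, ∃ ρ, IsStem q.1 ρ ∧ μ ≤ ρ.len := by
  obtain ⟨ρ, hρ⟩ := (hLaver p.1 p.2).exists_isStem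
  obtain ⟨σ, hσ, hρσ, hlen⟩ := (hLaver p.1 p.2).exists_mem_len_eq hκ hρ
    (max_lt ρ.len_lt hμ) (le_max_left _ _)
  obtain ⟨q, hq, hqσ⟩ := exists_le_isStem hκ hLaver hrestrict hρ hσ hρσ
  exact ⟨q, hq, σ, hqσ, hlen ▸ le_max_right _ _⟩

theorem IsStem.isInit_of_le (hκ : κ.IsRegular) (hLaver : ∀ T ∈ P, IsLaverTree T) {p q : P}
    (hqp : q ≤ p) {ρ ρ' : Node κ} (hρ : IsStem p.1 ρ) (hρ' : IsStem q.1 ρ') : IsInit ρ ρ' :=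
  hρ.isInit_of_subset hκ (hLaver q.1 q.2) hqp hρ'

/-- A condition decides exactly those values of the generic real that belong to its stem. -/
theorem fApp_genericReal (hκ : κ.IsRegular) (hLaver : ∀ T ∈ P, IsLaverTree T)
    (hrestrict : ∀ T ∈ P, ∀ σ ∈ T, restrict T σ ∈ P) {p : P} {ρ : Node κ} (hρ : IsStem p.1 ρ)
    {α β : Ordinal.{u}} : fApp (genericReal P) α β p ↔ ∃ b, HasVal ρ α b ∧ b.1 = β := by
  rw [genericReal, fApp_mk]
  constructor
  · intro h
    -- A common refinement has a stem extending both σ and the stem that witnesses the value β.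
    have key : ∀ q ≤ p, ∀ σ, IsStem q.1 σ → ∀ b, HasVal σ α b → b.1 = β := by
      intro q hq σ hσ b hb
      obtain ⟨r, hr, ⟨⟨⟨T, υ⟩, hυ⟩, ξ⟩, hrT, rfl, rfl⟩ := h q hq
      obtain ⟨ρ', hρ'⟩ := (hLaver r.1 r.2).exists_isStem
      have h₁ := (hσ.isInit_of_le hκ hLaver hr hρ').hasVal hb
      have h₂ := (IsStem.isInit_of_le hκ hLaver hrT hυ hρ').hasVal ⟨ξ.2, rfl⟩
      rw [h₁.unique h₂]
    rcases lt_or_ge α ρ.len with hα | hα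
    · obtain ⟨b, hb⟩ := exists_hasVal hα
      exact ⟨b, hb, key p le_rfl ρ hρ b hb⟩
    · exfalso
      have hT := hLaver p.1 p.2
      have hακ : α < κ.ord := by
        obtain ⟨r, hr, ⟨⟨⟨T, υ⟩, hυ⟩, ξ⟩, -, rfl, -⟩ := h p le_rfl
        exact lt_trans ξ.2 υ.len_lt
      obtain ⟨σ, hσ, hρσ, hlen⟩ := hT.exists_mem_len_eq hκ hρ hακ hα
      -- If α were beyond the stem, every successor of a node of length α would have to take the
      -- value β, although there are κ many.
      have hsucc : ∀ b ∈ succSet p.1 σ, b.1 = β := fun b hb => by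
        obtain ⟨τ, hτ, hστ, -, hval⟩ := exists_hasVal_of_mem_succSet hb
        obtain ⟨q, hq, hqτ⟩ := exists_le_isStem hκ hLaver hrestrict hρ hτ (hρσ.trans hστ)
        exact key q hq τ hqτ b (hlen ▸ hval)
      obtain ⟨a⟩ := nonempty_below hκ
      obtain ⟨b, hb, -⟩ := exists_gt_of_mk_eq hκ (hT.mk_succSet hρ σ hσ hρσ) a
      obtain ⟨b', hb', hlt⟩ := exists_gt_of_mk_eq hκ (hT.mk_succSet hρ σ hσ hρσ) b
      exact hlt.ne (Subtype.ext ((hsucc b hb).trans (hsucc b' hb').symm))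
  · rintro ⟨b, ⟨hα, rfl⟩, rfl⟩
    exact denseBelow_of_forall fun q hq => ⟨⟨⟨(p, ρ), hρ⟩, ⟨α, hα⟩⟩, hq, rfl, rfl⟩

theorem fFun_genericReal (hκ : κ.IsRegular) (hLaver : ∀ T ∈ P, IsLaverTree T)
    (hrestrict : ∀ T ∈ P, ∀ σ ∈ T, restrict T σ ∈ P) (p : P) :
    fFun (genericReal P) κ.ord κ.ord p := by
  refine fFun_mk (fun i => lt_trans i.2.2 i.1.1.2.len_lt) (fun i => (i.1.1.2.val i.2).2)
    (fun α hα q hq => ?_) ?_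
  · obtain ⟨r, hr, ρ, hρ, hlen⟩ := exists_le_isStem_len hκ hLaver hrestrict q
      ((Cardinal.isSuccLimit_ord hκ.aleph0_le).succ_lt hα)
    exact ⟨r, hr, ⟨⟨(r, ρ), hρ⟩, ⟨α, (Order.lt_succ α).trans_le hlen⟩⟩, le_rfl, rfl⟩
  · rintro ⟨⟨⟨T, σ⟩, hσ⟩, ξ⟩ ⟨⟨⟨T', σ'⟩, hσ'⟩, ξ'⟩ q - hi hj h
    obtain ⟨ρ, hρ⟩ := (hLaver q.1 q.2).exists_isStem
    have h₁ : HasVal ρ ξ.1 (σ.val ξ) :=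
      (IsStem.isInit_of_le hκ hLaver hi hσ hρ).hasVal ⟨ξ.2, rfl⟩
    have h₂ : HasVal ρ ξ'.1 (σ'.val ξ') :=
      (IsStem.isInit_of_le hκ hLaver hj hσ' hρ).hasVal ⟨ξ'.2, rfl⟩
    have h' : ξ.1 = ξ'.1 := h
    rw [h'] at h₁
    exact congrArg Subtype.val (h₁.unique h₂)

theorem fBranch_genericReal (hκ : κ.IsRegular) (hLaver : ∀ T ∈ P, IsLaverTree T)
    (hrestrict : ∀ T ∈ P, ∀ σ ∈ T, restrict T σ ∈ P) (p : P) :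
    fBranch (genericReal P) p.1 p := by
  refine ⟨fFun_genericReal hκ hLaver hrestrict p, fun α q hq => ?_⟩
  obtain ⟨r, hr, ρ, hρ, hlen⟩ := exists_le_isStem_len hκ hLaver hrestrict q α.2
  have hmem : ρ.take α.1 hlen ∈ p.1 :=
    (hLaver p.1 p.2).1 ρ (hq (hr hρ.1)) _ (ρ.isInit_take _ _)
  exact ⟨r, hr, ⟨ρ.take α.1 hlen, hmem, rfl⟩, fun ξ =>
    (fApp_genericReal hκ hLaver hrestrict hρ).2 ⟨_, ⟨ξ.2.trans_le hlen, rfl⟩, rfl⟩⟩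

theorem fBlockSup_genericReal (hκ : κ.IsRegular) (hLaver : ∀ T ∈ P, IsLaverTree T)
    (hrestrict : ∀ T ∈ P, ∀ σ ∈ T, restrict T σ ∈ P) {p : P} {ρ : Node κ} (hρ : IsStem p.1 ρ)
    {α δ : Ordinal.{u}} (h : BlockSup ρ α δ) : fBlockSup (genericReal P) α δ p := by
  constructor
  · intro n γ q hq hγ
    obtain ⟨ρ', hρ'⟩ := (hLaver q.1 q.2).exists_isStem
    obtain ⟨b, hb⟩ := (fApp_genericReal hκ hLaver hrestrict hρ').1 hγ
    exact (h.mono (hρ.isInit_of_le hκ hLaver hq hρ')).2.1 ⟨n, b, hb⟩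
  · intro ε q hq hε
    obtain ⟨ρ', hρ'⟩ := (hLaver q.1 q.2).exists_isStem
    refine (h.mono (hρ.isInit_of_le hκ hLaver hq hρ')).2.2 ?_
    rintro _ ⟨n, b, hb, rfl⟩
    exact hε n b.1 q le_rfl ((fApp_genericReal hκ hLaver hrestrict hρ').2 ⟨b, hb, rfl⟩)

theorem fBlockSup_unique {Q : Type (u + 1)} [Preorder Q] {x : PName Q} {α β γ : Ordinal.{u}}
    {p : Q} (hβ : fBlockSup x α β p) (hγ : fBlockSup x α γ p) : β = γ :=
  le_antisymm (hβ.2 γ p le_rfl hγ.1) (hγ.2 β p le_rfl hβ.1)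

/-- The canonical name of `φ(x_gen)`. -/
def codeName (P : Set (Set (Node κ))) (S : Set (Below κ)) : PName P :=
  .mk {i : P × Ordinal.{u} × Bool // ∃ ρ, IsStem i.1.1 ρ ∧ Codes S ρ i.2.1 i.2.2}
    (fun i => pairName (ordName i.1.2.1) (ordName (bit i.1.2.2))) (fun i => i.1.1)

variable {S : Set (Below κ)}

theorem fApp_codeName (hκ : κ.IsRegular) (hLaver : ∀ T ∈ P, IsLaverTree T) {p : P}
    {α β : Ordinal.{u}} : fApp (codeName P S) α β p ↔
      DenseBelow p fun q => ∃ ρ b, IsStem q.1 ρ ∧ Codes S ρ α b ∧ bit b = β := by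
  rw [codeName, fApp_mk]
  constructor
  · refine fun h => h.imp ?_
    rintro q - ⟨⟨⟨T, α, b⟩, σ, hσ, hb⟩, hq, rfl, rfl⟩
    obtain ⟨ρ, hρ⟩ := (hLaver q.1 q.2).exists_isStem
    exact ⟨ρ, b, hρ, hb.mono (hσ.isInit_of_le hκ hLaver hq hρ), rfl⟩
  · refine fun h => h.imp ?_
    rintro q - ⟨ρ, b, hρ, hb, h⟩
    exact ⟨⟨(q, α, b), ρ, hρ, hb⟩, le_rfl, rfl, h⟩

theorem omega0_mul_add_lt (hκ : κ.IsRegular) (hκ' : Cardinal.aleph0 < κ) {α : Ordinal.{u}}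
    (hα : α < κ.ord) : Ordinal.omega0 * α + Ordinal.omega0 < κ.ord := by
  have hω : Ordinal.omega0 < κ.ord := by
    rw [← Cardinal.ord_aleph0]; exact Cardinal.ord_lt_ord.2 hκ'
  exact Ordinal.isPrincipal_add_ord hκ.aleph0_le
    (Ordinal.isPrincipal_mul_ord hκ.aleph0_le hω hα) hω

theorem fFun_codeName (hκ : κ.IsRegular) (hκ' : Cardinal.aleph0 < κ)
    (hLaver : ∀ T ∈ P, IsLaverTree T) (hrestrict : ∀ T ∈ P, ∀ σ ∈ T, restrict T σ ∈ P) (p : P) :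
    fFun (codeName P S) κ.ord 2 p := by
  refine fFun_mk ?_ ?_ (fun α hα q hq => ?_) ?_
  · rintro ⟨⟨T, α, b⟩, σ, hσ, δ, hδ, -⟩
    refine lt_of_le_of_lt ?_ σ.len_lt
    exact (Ordinal.le_mul_right α Ordinal.omega0_pos).trans (le_self_add.trans hδ.1)
  · rintro ⟨⟨T, α, b⟩, -⟩
    cases b
    · simp [bit]
    · simp [bit]
  · obtain ⟨r, hr, ρ, hρ, hlen⟩ := exists_le_isStem_len hκ hLaver hrestrict q
      (omega0_mul_add_lt hκ hκ' hα)
    obtain ⟨b, hb⟩ := exists_codes S hlen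
    exact ⟨r, hr, ⟨(r, α, b), ρ, hρ, hb⟩, le_rfl, rfl⟩
  · rintro ⟨⟨T, α, b⟩, σ, hσ, hb⟩ ⟨⟨T', α', b'⟩, σ', hσ', hb'⟩ q - hi hj h
    obtain rfl : α = α' := h
    obtain ⟨ρ, hρ⟩ := (hLaver q.1 q.2).exists_isStem
    have h₁ := hb.mono (hσ.isInit_of_le hκ hLaver hi hρ)
    have h₂ := hb'.mono (hσ'.isInit_of_le hκ hLaver hj hρ)
    exact congrArg bit (h₁.unique h₂)

theorem fPhi_codeName (hκ : κ.IsRegular) (hκ' : Cardinal.aleph0 < κ)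
    (hLaver : ∀ T ∈ P, IsLaverTree T) (hrestrict : ∀ T ∈ P, ∀ σ ∈ T, restrict T σ ∈ P) (p : P) :
    fPhi S (genericReal P) (codeName P S) p := by
  refine ⟨fFun_codeName hκ hκ' hLaver hrestrict p, fun α => ⟨fun q _ h => ?_, fun q _ h => ?_⟩⟩
  · refine ((fApp_codeName hκ hLaver).1 h).imp ?_
    rintro r - ⟨ρ, b, hρ, ⟨δ, hδ, hb⟩, h1⟩
    obtain rfl : b = true := by
      cases b
      · simp [bit] at h1
      · rfl
    obtain ⟨β, hβ, rfl⟩ := hb.1 rfl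
    exact ⟨⟨β, hβ⟩, fBlockSup_genericReal hκ hLaver hrestrict hρ hδ⟩
  · refine (fApp_codeName hκ hLaver).2 fun r hr => ?_
    obtain ⟨r', hr', β, hβ⟩ := h r hr
    -- Lengthening the stem past the block decides its supremum, which must then be the β in S
    -- already forced to be it.
    obtain ⟨s, hs, ρ, hρ, hlen⟩ := exists_le_isStem_len hκ hLaver hrestrict r'
      (omega0_mul_add_lt hκ hκ' α.2)
    obtain ⟨δ, hδ⟩ := exists_blockSup hlen
    have hδβ : δ = β.1.1 := fBlockSup_unique
      (fBlockSup_genericReal hκ hLaver hrestrict hρ hδ) (fBlockSup_mono hβ hs)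
    exact ⟨s, hs.trans hr', ρ, true, hρ, ⟨δ, hδ, fun _ => ⟨β.1, β.2, hδβ.symm⟩, fun _ => rfl⟩,
      rfl⟩

theorem fCohen_codeName (hκ : κ.IsRegular) (hκ' : Cardinal.aleph0 < κ)
    (hLaver : ∀ T ∈ P, IsLaverTree T) (hrestrict : ∀ T ∈ P, ∀ σ ∈ T, restrict T σ ∈ P)
    {S₀ S₁ : Set (Below κ)} (hcof : S₀ ∪ S₁ = cofOmega κ) (hdisj : Disjoint S₀ S₁)
    (hS₀ : IsStationary S₀) (hS₁ : IsStationary S₁) (p : P) :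
    fCohen κ (codeName P S₁) p := by
  refine ⟨fFun_codeName hκ hκ' hLaver hrestrict p, fun ⟨D, hD⟩ q _ => ?_⟩
  have hT := hLaver q.1 q.2
  obtain ⟨ρ, hρ⟩ := hT.exists_isStem
  -- The length ω·|ρ| is at least |ρ| and ends at a block boundary; the |ρ| bits coded so far form
  -- s, which D must be asked to extend.
  obtain ⟨σ, hσ, hρσ, hlen⟩ := hT.exists_mem_len_eq hκ hρ
    (le_self_add.trans_lt (omega0_mul_add_lt hκ hκ' ρ.len_lt))
    (Ordinal.le_mul_right ρ.len Ordinal.omega0_pos)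
  obtain ⟨s, hs, hsc⟩ := exists_bSeq_of_forall ρ.len ρ.len_lt (R := Codes S₁ σ) fun η hη => by
    refine exists_codes S₁ ?_
    rw [hlen, ← Ordinal.mul_succ]
    exact mul_le_mul_right (Order.succ_le_of_lt hη) _
  obtain ⟨t, ht, hst⟩ := hD s
  obtain ⟨τ, hτ, hστ, hτc⟩ := exists_coding hκ hκ' hT.1 hT.2.1 (hT.mk_succSet hρ) hcof hdisj
    hS₀ hS₁ hσ hρσ hlen (hs ▸ hst.len_le)
    fun η hη b hb => hsc η b (hst.hasVal_of_lt hb (hs ▸ hη))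
  obtain ⟨r, hr, hrτ⟩ := exists_le_isStem hκ hLaver hrestrict hρ hτ (hρσ.trans hστ)
  refine ⟨r, hr, ⟨t, ht⟩, fun η =>
    (fApp_codeName hκ hLaver).2 (denseBelow_of_forall fun r' hr' => ?_)⟩
  obtain ⟨ρ', hρ'⟩ := (hLaver r'.1 r'.2).exists_isStem
  exact ⟨ρ', _, hρ', (hτc η.1 _ ⟨η.2, rfl⟩).mono (hrτ.isInit_of_le hκ hLaver hr' hρ'), rfl⟩

end Generic

end LaverForcing

theorem theorem3p5 (κ : Cardinal.{u}) (hκ : κ.IsRegular) (hκ' : Cardinal.aleph0 < κ)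
    (P : Set (Set (LaverForcing.Node κ)))
    (hLaver : ∀ T ∈ P, LaverForcing.IsLaverTree T)
    (hrestrict : ∀ T ∈ P, ∀ σ ∈ T, LaverForcing.restrict T σ ∈ P) :
    LaverForcing.AddsCohenReal κ P ∧
    -- `x_gen` is an element of `κ^κ`, and a branch through every tree in the generic filter
    LaverForcing.Forced (LaverForcing.fFun (LaverForcing.genericReal P) κ.ord κ.ord) ∧
    (∀ T : P, LaverForcing.fBranch (LaverForcing.genericReal P) T.1 T) ∧
    -- `φ(x_gen)` is a Cohen `κ`-real
    ∀ S₀ S₁ : Set (LaverForcing.Below κ),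
      S₀ ∪ S₁ = LaverForcing.cofOmega κ → Disjoint S₀ S₁ →
      IsStationary S₀ → IsStationary S₁ →
      ∃ c : LaverForcing.PName P,
        LaverForcing.Forced (LaverForcing.fPhi S₁ (LaverForcing.genericReal P) c) ∧
        LaverForcing.Forced (LaverForcing.fCohen κ c) := by
  refine ⟨?_, LaverForcing.fFun_genericReal hκ hLaver hrestrict,
    LaverForcing.fBranch_genericReal hκ hLaver hrestrict, fun S₀ S₁ hcof hdisj hS₀ hS₁ =>
      ⟨LaverForcing.codeName P S₁, LaverForcing.fPhi_codeName hκ hκ' hLaver hrestrict,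
        LaverForcing.fCohen_codeName hκ hκ' hLaver hrestrict hcof hdisj hS₀ hS₁⟩⟩
  -- The first claim mentions no partition, so one has to be supplied.
  obtain ⟨S₀, S₁, hcof, hdisj, hS₀, hS₁⟩ := LaverForcing.exists_stationary_partition hκ hκ'
  exact ⟨LaverForcing.codeName P S₁,
    LaverForcing.fCohen_codeName hκ hκ' hLaver hrestrict hcof hdisj hS₀ hS₁⟩
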